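/- For a finite graph $\Gamma$, let $\mathrm{cut}(\Gamma)$ be the minimum cardinality of a set $S$ of vertices such that every connected component of $\Gamma-S$ has at most $\frac12|V\Gamma|$ vertices. The separation profile of a graph $X$ is the function $\mathrm{sep}_X:\mathbb N\to\mathbb N$, $$\mathrm{sep}_X(r)=\max\{\mathrm{cut}(\Gamma) : \Gamma\text{ a finite subgraph of } X,\ |V\Gamma|\le r\}.$$ For $f,g:\mathbb N\to\mathbb N$ write $f\lesssim g$ if there is a constant $C\in\mathbb N$ with $f(r)\le C\,g(Cr)+C$ for all $r\in\mathbb N$, and $f\simeq g$ if $f\lesssim g$ and $g\lesssim f$. For a finitely generated group $G$, let $\mathrm{sep}_G$ denote the separation profile of the Cayley graph of $G$ with respect to any finite generating set. **Theorem.** Let $G$ and $H$ be finitely generated groups. Then the free product $G*H$ is finitely generated and $$\mathrm{sep}_{G*H}(r)\simeq\max\{\mathrm{sep}_G(r),\mathrm{sep}_H(r)\},$$ for every choice of finite generating sets of $G$, $H$ and $G*H$. -/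

import Mathlib

/-- `S` is a cutset of the finite graph `Γ`: every connected component of the graph `Γ - S`,
obtained by deleting the vertices in `S`, contains at most half of the vertices of `Γ`. -/
def SimpleGraph.IsCutset {V : Type*} (Γ : SimpleGraph V) (S : Finset V) : Prop :=
  ∀ C : (Γ.induce {v : V | v ∉ S}).ConnectedComponent, 2 * C.supp.ncard ≤ Nat.card V

/-- The cutsize of a finite graph: the minimum cardinality of a cutset
(the set of all vertices is always a cutset). -/
noncomputable def SimpleGraph.cutsize {V : Type*} (Γ : SimpleGraph V) : ℕ :=
  sInf {k : ℕ | ∃ S : Finset V, Γ.IsCutset S ∧ S.card = k}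

/-- The separation profile of a graph `X`: the maximum of the cutsizes of the finite subgraphs
of `X` with at most `r` vertices (a nonempty set of natural numbers bounded by `r`). -/
noncomputable def SimpleGraph.sepProfile {V : Type*} (X : SimpleGraph V) (r : ℕ) : ℕ :=
  sSup {k : ℕ | ∃ Γ : X.Subgraph, Γ.verts.Finite ∧ Γ.verts.ncard ≤ r ∧ Γ.coe.cutsize = k}

/-- `f ≲ g`: there is a constant `C` with `f r ≤ C * g (C * r) + C` for all `r`. -/
def CoarseLE (f g : ℕ → ℕ) : Prop :=
  ∃ C : ℕ, ∀ r : ℕ, f r ≤ C * g (C * r) + C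

/-- `f ≃ g`: both `f ≲ g` and `g ≲ f`. -/
def CoarseEquiv (f g : ℕ → ℕ) : Prop :=
  CoarseLE f g ∧ CoarseLE g f

/-- `S` is a finite generating set of the group `G`. -/
def IsFiniteGenSet {G : Type*} [Group G] (S : Finset G) : Prop :=
  Subgroup.closure (S : Set G) = ⊤

/-- The separation profile of the Cayley graph of `G` with respect to `S`. -/
noncomputable def groupSep {G : Type*} [Group G] (S : Finset G) : ℕ → ℕ :=
  (SimpleGraph.mulCayley (S : Set G)).sepProfile

open Finset

/-! Both factors embed in the free product, and separation profiles are coarsely monotone under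
injective homomorphisms (`groupSep_coarseLE_of_injective`). This is the lower bound.

For the upper bound, the cosets of the factors are arranged like a tree. If a finite set `K` has no
cheap separator, then after deleting any point a heavy piece survives on one side of that point, and
a smallest heavy side singles out a coset `v * M i`. The projection to this coset is constant along
edges outside it, so it keeps connected sets connected. Give each point of the coset the weight of
its fibre: a separator inside the coset then separates `K`, a contradiction
(`Monoid.CoprodI.exists_separates`).

The profile, however, only provides separators for the counting measure.
`SimpleGraph.exists_separates_of_forall_card` passes to arbitrary weights. Among heavy sets take `D`
minimizing volume plus `M` times boundary, and attach to it a set `Q` with `M` vertices per boundary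
vertex, spread out by a flow obtained from Hall's theorem. Minimality and the flow together prevent
a small set from halving `D ∪ Q`. -/

/-- `C` is connected in the graph `X` (possibly empty): the only subsets of `C` without edges to
their complement in `C` are the empty set and `C`. -/
def SimpleGraph.ConnOn {V : Type*} (X : SimpleGraph V) (C : Set V) : Prop :=
  ∀ D : Set V, (C ∩ D).Nonempty → (∀ x ∈ C ∩ D, ∀ y ∈ C, X.Adj x y → y ∈ D) → C ⊆ D

/-- Every connected subset of `K` disjoint from `Z` has weight at most `W / 2`. -/
def SimpleGraph.Separates {V : Type*} (X : SimpleGraph V) (K Z : Finset V) (w : V → ℕ) (W : ℕ) :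
    Prop :=
  ∀ C : Finset V, C ⊆ K → Disjoint C Z → X.ConnOn C → 2 * ∑ v ∈ C, w v ≤ W

/-! ### Connected sets and heavy components. -/

namespace SimpleGraph

variable {V V' : Type*} {X : SimpleGraph V} {Y : SimpleGraph V'}

lemma connOn_singleton (a : V) : X.ConnOn {a} := by
  rintro D ⟨x, hx, hxD⟩ - y hy
  rw [Set.mem_singleton_iff] at hx hy
  rwa [hy, ← hx]

lemma ConnOn.union {A B : Set V} (hA : X.ConnOn A) (hB : X.ConnOn B)
    (h : ∃ x ∈ A, ∃ y ∈ B, x = y ∨ X.Adj x y) : X.ConnOn (A ∪ B) := by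
  obtain ⟨x, hx, y, hy, hxy⟩ := h
  intro D hne hD
  have hA' : (A ∩ D).Nonempty → A ⊆ D := fun h =>
    hA D h fun u hu v hv huv => hD u ⟨.inl hu.1, hu.2⟩ v (.inl hv) huv
  have hB' : (B ∩ D).Nonempty → B ⊆ D := fun h =>
    hB D h fun u hu v hv huv => hD u ⟨.inr hu.1, hu.2⟩ v (.inr hv) huv
  have hxyD : x ∈ D ↔ y ∈ D := by
    rcases hxy with rfl | hxy
    · rfl
    · exact ⟨fun h => hD x ⟨.inl hx, h⟩ y (.inr hy) hxy,
        fun h => hD y ⟨.inr hy, h⟩ x (.inl hx) hxy.symm⟩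
  have key : A ⊆ D ∧ B ⊆ D := by
    obtain ⟨z, hz | hz, hzD⟩ := hne
    · have h1 := hA' ⟨z, hz, hzD⟩
      exact ⟨h1, hB' ⟨y, hy, hxyD.1 (h1 hx)⟩⟩
    · have h1 := hB' ⟨z, hz, hzD⟩
      exact ⟨hA' ⟨x, hx, hxyD.2 (h1 hy)⟩, h1⟩
  exact Set.union_subset key.1 key.2

/-- A union of connected sets indexed by a connected set is connected if the sets attached to
adjacent indices intersect. -/
lemma ConnOn.biUnion {C : Set V} (hC : X.ConnOn C) {B : V → Set V'}
    (hB : ∀ x ∈ C, Y.ConnOn (B x))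
    (h : ∀ x ∈ C, ∀ y ∈ C, X.Adj x y → (B x ∩ B y).Nonempty) :
    Y.ConnOn (⋃ x ∈ C, B x) := by
  intro D hne hD
  have hB' : ∀ x ∈ C, (B x ∩ D).Nonempty → B x ⊆ D := fun x hx hxD =>
    hB x hx D hxD fun u hu v hv huv =>
      hD u ⟨Set.mem_biUnion hx hu.1, hu.2⟩ v (Set.mem_biUnion hx hv) huv
  have key : C ⊆ {x | B x ⊆ D} := by
    refine hC _ ?_ ?_
    · obtain ⟨z, hz, hzD⟩ := hne
      simp only [Set.mem_iUnion] at hz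
      obtain ⟨x, hx, hzx⟩ := hz
      exact ⟨x, hx, hB' x hx ⟨z, hzx, hzD⟩⟩
    · rintro x ⟨hx, hxD⟩ y hy hxy
      obtain ⟨z, hzx, hzy⟩ := h x hx y hy hxy
      exact hB' y hy ⟨z, hzy, hxD hzx⟩
  exact Set.iUnion₂_subset key

lemma ConnOn.image {C : Set V} (hC : X.ConnOn C) {f : V → V'}
    (h : ∀ x ∈ C, ∀ y ∈ C, X.Adj x y → f x = f y ∨ Y.Adj (f x) (f y)) : Y.ConnOn (f '' C) := by
  rintro D ⟨-, ⟨x, hx, rfl⟩, hxD⟩ hD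
  have key : C ⊆ f ⁻¹' D := by
    refine hC _ ⟨x, hx, hxD⟩ ?_
    rintro u ⟨hu, huD⟩ v hv huv
    rcases h u hu v hv huv with e | e
    · rw [Set.mem_preimage, ← e]; exact huD
    · exact hD _ ⟨⟨u, hu, rfl⟩, huD⟩ _ ⟨v, hv, rfl⟩ e
  exact Set.image_subset_iff.2 key

/-- A connected subset of a finite set is contained in a connected component of it. -/
lemma ConnOn.exists_component [DecidableEq V] {D L : Finset V} (hD : X.ConnOn D) (hDL : D ⊆ L) :
    ∃ C : Finset V, D ⊆ C ∧ C ⊆ L ∧ X.ConnOn C ∧ ∀ x ∈ C, ∀ y ∈ L, X.Adj x y → y ∈ C := by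
  classical
  obtain ⟨C, hC, hmax⟩ := exists_max_image
    (L.powerset.filter fun C => D ⊆ C ∧ X.ConnOn C) card ⟨D, by simp [hDL, hD]⟩
  simp only [mem_filter, mem_powerset] at hC hmax
  refine ⟨C, hC.2.1, hC.1, hC.2.2, fun x hx y hy hxy => ?_⟩
  by_contra hyC
  have h1 := hmax (C ∪ {y}) ⟨union_subset hC.1 (by simpa using hy),
    hC.2.1.trans subset_union_left, by
      push_cast
      exact hC.2.2.union (connOn_singleton y) ⟨x, hx, y, rfl, .inr hxy⟩⟩
  rw [card_union_of_disjoint (by simpa using hyC)] at h1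
  simp at h1

/-- If `Z` fails to separate `K`, then some component of `K \ Z` is heavy. -/
lemma exists_heavy_component [DecidableEq V] {K Z : Finset V} {w : V → ℕ} {W : ℕ}
    (h : ¬ X.Separates K Z w W) :
    ∃ C : Finset V, C ⊆ K ∧ Disjoint C Z ∧ X.ConnOn C ∧ W < 2 * ∑ v ∈ C, w v ∧
      ∀ x ∈ C, ∀ y ∈ K, X.Adj x y → y ∈ C ∨ y ∈ Z := by
  simp only [Separates, not_forall, not_le] at h
  obtain ⟨D, hDK, hDZ, hD, hW⟩ := h
  obtain ⟨C, hDC, hCL, hC, hcl⟩ := hD.exists_component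
    (L := K \ Z) (fun x hx => mem_sdiff.2 ⟨hDK hx, Finset.disjoint_left.1 hDZ hx⟩)
  refine ⟨C, fun x hx => (mem_sdiff.1 (hCL hx)).1,
    Finset.disjoint_left.2 fun x hx => (mem_sdiff.1 (hCL hx)).2, hC,
    hW.trans_le (Nat.mul_le_mul_left _ (sum_le_sum_of_subset hDC)), fun x hx y hy hxy => ?_⟩
  by_cases hyZ : y ∈ Z
  · exact .inr hyZ
  · exact .inl (hcl x hx y (mem_sdiff.2 ⟨hy, hyZ⟩) hxy)

/-! ### Cutsets of subgraphs and separators of finite vertex sets. -/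

lemma cutsize_le_of_isCutset {Γ : SimpleGraph V} {S : Finset V} (h : Γ.IsCutset S) :
    Γ.cutsize ≤ S.card :=
  Nat.sInf_le ⟨S, h, rfl⟩

lemma isCutset_univ [Fintype V] (Γ : SimpleGraph V) : Γ.IsCutset univ := by
  intro C
  obtain ⟨⟨v, hv⟩, -⟩ := C.nonempty_supp
  exact absurd (mem_univ v) hv

lemma exists_isCutset_card_eq [Finite V] (Γ : SimpleGraph V) :
    ∃ S : Finset V, Γ.IsCutset S ∧ S.card = Γ.cutsize := by
  have := Fintype.ofFinite V
  exact Nat.sInf_mem (s := {k : ℕ | ∃ S : Finset V, Γ.IsCutset S ∧ S.card = k})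
    ⟨_, univ, Γ.isCutset_univ, rfl⟩

lemma cutsize_le_sepProfile (Γ : X.Subgraph) (hf : Γ.verts.Finite) {r : ℕ}
    (hr : Γ.verts.ncard ≤ r) : Γ.coe.cutsize ≤ X.sepProfile r := by
  refine le_csSup ⟨r, ?_⟩ ⟨Γ, hf, hr, rfl⟩
  rintro k ⟨Δ, hΔ, hΔr, rfl⟩
  have := hΔ.fintype
  refine (cutsize_le_of_isCutset Δ.coe.isCutset_univ).trans ?_
  rwa [card_univ, ← Nat.card_eq_fintype_card, Nat.card_coe_set_eq]

lemma connOn_image_supp {Γ : X.Subgraph} (S : Set Γ.verts)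
    (C : (Γ.coe.induce S).ConnectedComponent) :
    X.ConnOn ((fun v : S => (v.1 : V)) '' C.supp) := by
  rintro D ⟨-, ⟨x, hx, rfl⟩, hxD⟩ hD
  rintro - ⟨y, hy, rfl⟩
  have hxy : (Γ.coe.induce S).Reachable x y :=
    ConnectedComponent.exact ((ConnectedComponent.mem_supp_iff _ _).1 hx |>.trans
      ((ConnectedComponent.mem_supp_iff _ _).1 hy).symm)
  obtain ⟨p⟩ := hxy
  clear hy
  induction p with
  | nil => exact hxD
  | @cons u v _ huv _ ih =>
    have hv : v ∈ C.supp := by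
      rw [ConnectedComponent.mem_supp_iff] at hx ⊢
      rw [← hx]
      exact ConnectedComponent.sound huv.symm.reachable
    refine ih hv (hD _ ⟨⟨u, hx, rfl⟩, hxD⟩ _ ⟨v, hv, rfl⟩ ?_)
    exact Γ.adj_sub huv

/-- A component of a subgraph of `X` is connected in `X` even if the subgraph is not induced, so
only vertex sets matter. -/
lemma sepProfile_le {r m : ℕ} (h : ∀ K : Finset V, K.card ≤ r →
    ∃ Z : Finset V, Z.card ≤ m ∧ X.Separates K Z (fun _ => 1) K.card) : X.sepProfile r ≤ m := by
  classical
  refine csSup_le' ?_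
  rintro k ⟨Γ, hf, hr, rfl⟩
  have hcard : hf.toFinset.card = Γ.verts.ncard := (Set.ncard_eq_toFinset_card _ hf).symm
  obtain ⟨Z, hZm, hZ⟩ := h hf.toFinset (hcard.trans_le hr)
  refine (cutsize_le_of_isCutset (S := Z.subtype (· ∈ Γ.verts)) ?_).trans
    (((card_subtype _ _).trans_le (card_filter_le _ _)).trans hZm)
  intro C
  have hinj : Function.Injective (fun v : {v : Γ.verts | v ∉ Z.subtype (· ∈ Γ.verts)} =>
      (v.1 : V)) := Subtype.val_injective.comp Subtype.val_injective
  have hsub : ((fun v : {v : Γ.verts | v ∉ Z.subtype (· ∈ Γ.verts)} => (v.1 : V)) '' C.supp) ⊆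
      Γ.verts := by rintro - ⟨y, -, rfl⟩; exact y.1.2
  have hfC := hf.subset hsub
  have h1 := hZ hfC.toFinset (by simpa using hsub) ?_ (by
    rw [hfC.coe_toFinset]; exact connOn_image_supp _ C)
  · rw [sum_const, smul_eq_mul, mul_one, ← Set.ncard_eq_toFinset_card _ hfC,
      Set.ncard_image_of_injective _ hinj, hcard] at h1
    rwa [Nat.card_coe_set_eq]
  · rw [Finset.disjoint_left]
    intro x hx hxZ
    rw [hfC.mem_toFinset] at hx
    obtain ⟨y, -, rfl⟩ := hx
    exact y.2 (by simpa using hxZ)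

/-- The cutsize is applied to the subgraph induced on `K`: having all edges of `X`, it puts each
connected set avoiding the cutset inside one component. -/
lemma exists_separates_card {K : Finset V} {r : ℕ} (hK : K.card ≤ r) :
    ∃ Z : Finset V, Z.card ≤ X.sepProfile r ∧ X.Separates K Z (fun _ => 1) K.card := by
  classical
  let Γ : X.Subgraph := (⊤ : X.Subgraph).induce (K : Set V)
  have hv : Γ.verts = K := rfl
  have hf : Γ.verts.Finite := K.finite_toSet
  have hn : Γ.verts.ncard = K.card := by rw [hv, Set.ncard_coe_finset]
  have : Finite Γ.verts := hf
  obtain ⟨S, hS, hSc⟩ := Γ.coe.exists_isCutset_card_eq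
  refine ⟨S.map (Function.Embedding.subtype _), ?_, ?_⟩
  · rw [card_map, hSc]
    exact cutsize_le_sepProfile Γ hf (hn.trans_le hK)
  · intro C hCK hCS hC
    rw [sum_const, smul_eq_mul, mul_one]
    rcases C.eq_empty_or_nonempty with rfl | ⟨x, hx⟩
    · simp
    have hmem : ∀ y ∈ C, ∃ h : y ∈ Γ.verts, (⟨y, h⟩ : Γ.verts) ∈ {v : Γ.verts | v ∉ S} := by
      intro y hy
      refine ⟨hCK hy, fun hyS => Finset.disjoint_left.1 hCS hy ?_⟩
      exact mem_map.2 ⟨_, hyS, rfl⟩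
    obtain ⟨hx1, hx2⟩ := hmem x hx
    let x' : {v : Γ.verts | v ∉ S} := ⟨⟨x, hx1⟩, hx2⟩
    have hsub : (C : Set V) ⊆ (fun v : {v : Γ.verts | v ∉ S} => (v.1 : V)) ''
        ((Γ.coe.induce {v : Γ.verts | v ∉ S}).connectedComponentMk x').supp := by
      refine hC _ ⟨x, hx, x', by simp, rfl⟩ ?_
      rintro - ⟨hu, ⟨u, hu', rfl⟩⟩ v hv huv
      obtain ⟨hv1, hv2⟩ := hmem v hv
      refine ⟨⟨⟨v, hv1⟩, hv2⟩, ?_, rfl⟩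
      rw [ConnectedComponent.mem_supp_iff] at hu' ⊢
      rw [← hu']
      refine ConnectedComponent.sound (Adj.reachable ?_)
      change Γ.Adj v u.1
      exact ⟨hv1, u.1.2, huv.symm⟩
    have h1 := hS ((Γ.coe.induce {v : Γ.verts | v ∉ S}).connectedComponentMk x')
    have h2 := (Set.ncard_le_ncard hsub (Set.toFinite _)).trans (Set.ncard_image_le (Set.toFinite _))
    rw [Set.ncard_coe_finset] at h2
    rw [Nat.card_coe_set_eq, hn] at h1
    omega

lemma sepProfile_mono : Monotone X.sepProfile := fun _ _ h =>
  sepProfile_le fun _ hK => exists_separates_card (hK.trans h)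

end SimpleGraph

/-! ### Absorbing flows from Hall's theorem. -/

/-- An integral flow on `A` with `M` units emitted at every vertex of `S`: `f a b` is the flow from
`a` to `b`, no flow enters `S`, every vertex `a` absorbs `g a ≤ 1` units, at least what arrives at a
vertex leaves it or is absorbed, and this is at most `M`. -/
structure IsAbsorbingFlow {V : Type*} [DecidableEq V] (r : V → V → Prop) (A S : Finset V) (M : ℕ)
    (f : V → V → ℕ) (g : V → ℕ) : Prop where
  of_pos : ∀ a ∈ A, ∀ b ∈ A, 0 < f a b → b ∉ S ∧ (a = b ∨ r a b)
  absorb_le_one : ∀ a ∈ A, g a ≤ 1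
  balance : ∀ a ∈ A, (∑ b ∈ A, f b a + if a ∈ S then M else 0) ≤ ∑ b ∈ A, f a b + g a ∧
    ∑ b ∈ A, f a b + g a ≤ M

/-- Hall's theorem turns the cut condition into an absorbing flow. -/
lemma exists_isAbsorbingFlow {V : Type*} [DecidableEq V] (r : V → V → Prop) [DecidableRel r]
    {A S : Finset V} {M : ℕ} (hM : 0 < M)
    (hP : ∀ R ⊆ A,
      M * #(R ∩ S) ≤ M * #{b ∈ A | b ∉ R ∧ b ∉ S ∧ ∃ a ∈ R, r a b} + #R) :
    ∃ f g, IsAbsorbingFlow r A S M f g := by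
  classical
  -- Every vertex holds `M` tokens. A token may take one of the `M` transit slots at its own vertex
  -- or at an `r`-successor, outside `S`, or the single absorbing slot of its vertex. Transit slots
  -- at its own vertex serve as unused capacity.
  let t : A × Fin M → Finset ((V × Fin M) ⊕ V) := fun x =>
    ({b ∈ A | b ∉ S ∧ (x.1.1 = b ∨ r x.1.1 b)} ×ˢ univ).disjSum {x.1.1}
  obtain ⟨φ, hφ, hφt⟩ := (Finset.all_card_le_biUnion_card_iff_exists_injective t).1 (by
    intro s
    let R : Finset V := s.image fun x => x.1.1
    have hRA : R ⊆ A := fun x hx => by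
      obtain ⟨y, -, rfl⟩ := mem_image.1 hx; exact y.1.2
    have h1 : #s ≤ #R * M := by
      have : #(s.map ⟨fun x => (x.1.1, x.2), by
          rintro ⟨⟨a, _⟩, i⟩ ⟨⟨b, _⟩, k⟩ h; simpa using h⟩) ≤ #(R ×ˢ (univ : Finset (Fin M))) := by
        refine card_le_card fun y hy => ?_
        obtain ⟨x, hx, rfl⟩ := mem_map.1 hy
        exact mem_product.2 ⟨mem_image.2 ⟨x, hx, rfl⟩, mem_univ _⟩
      simpa using this
    have h2 : ((((R \ S) ∪ {b ∈ A | b ∉ R ∧ b ∉ S ∧ ∃ a ∈ R, r a b}) ×ˢ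
        (univ : Finset (Fin M))).disjSum R) ⊆ s.biUnion t := by
      intro y hy
      rw [mem_biUnion]
      rcases y with ⟨b, i⟩ | b
      · simp only [inl_mem_disjSum, mem_product, mem_union, mem_sdiff, mem_filter, mem_univ,
          and_true] at hy
        rcases hy with ⟨hb, hbS⟩ | ⟨hbA, -, hbS, a, ha, hab⟩
        · obtain ⟨x, hx, rfl⟩ := mem_image.1 hb
          exact ⟨x, hx, by simp [t, hbS]⟩
        · obtain ⟨x, hx, rfl⟩ := mem_image.1 ha
          exact ⟨x, hx, by simp [t, hbS, hbA, hab]⟩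
      · obtain ⟨x, hx, rfl⟩ := mem_image.1 (inr_mem_disjSum.1 hy)
        exact ⟨x, hx, by simp [t]⟩
    refine le_trans ?_ (card_le_card h2)
    rw [card_disjSum, card_product, card_univ, Fintype.card_fin, card_union_of_disjoint]
    · have h3 := hP R hRA
      have h4 := card_sdiff_add_card_inter R S
      calc #s ≤ #R * M := h1
        _ = #(R \ S) * M + M * #(R ∩ S) := by rw [← h4]; ring
        _ ≤ _ := by linarith
    · rw [Finset.disjoint_left]
      intro x hx hx'
      exact (mem_filter.1 hx').2.1 (mem_sdiff.1 hx).1)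
  let ψ : V → Fin M → (V × Fin M) ⊕ V := fun a i => if h : a ∈ A then φ (⟨a, h⟩, i) else .inr a
  have hψ : ∀ a ∈ A, ∀ b ∈ A, ∀ i k, ψ a i = ψ b k → a = b ∧ i = k := by
    intro a ha b hb i k h
    simp only [ψ, ha, hb, dif_pos] at h
    simpa using hφ h
  have hψt : ∀ a ∈ A, ∀ i, ψ a i = .inr a ∨
      ∃ b ∈ A, b ∉ S ∧ (a = b ∨ r a b) ∧ ∃ k, ψ a i = .inl (b, k) := by
    intro a ha i
    have h := hφt (⟨a, ha⟩, i)
    simp only [ψ, ha, dif_pos]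
    rcases hx : φ (⟨a, ha⟩, i) with ⟨b, k⟩ | b
    · rw [hx] at h
      simp only [t, inl_mem_disjSum, mem_product, mem_filter] at h
      exact .inr ⟨b, h.1.1, h.1.2.1, h.1.2.2, k, rfl⟩
    · rw [hx] at h
      simp only [t, inr_mem_disjSum, mem_singleton] at h
      exact .inl (by rw [h])
  let c : V → V → ℕ := fun a b => #{i : Fin M | ∃ k, ψ a i = .inl (b, k)}
  let g : V → ℕ := fun a => #{i : Fin M | ψ a i = .inr a}
  have hout : ∀ a ∈ A, ∑ b ∈ A, c a b + g a = M := by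
    intro a ha
    have h1 : (univ : Finset (Fin M)) =
        (A.biUnion fun b => {i : Fin M | ∃ k, ψ a i = .inl (b, k)}) ∪
          ({i : Fin M | ψ a i = .inr a} : Finset (Fin M)) := by
      ext i
      simp only [mem_univ, mem_union, mem_biUnion, mem_filter, true_and, true_iff]
      rcases hψt a ha i with h | ⟨b, hb, -, -, k, hk⟩
      · exact .inr h
      · exact .inl ⟨b, hb, k, hk⟩
    have h2 := congrArg card h1
    rw [card_univ, Fintype.card_fin, card_union_of_disjoint, card_biUnion] at h2
    · exact h2.symm
    · intro b _ d _ hbd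
      refine Finset.disjoint_left.2 fun i hi hi' => ?_
      simp only [mem_filter, mem_univ, true_and] at hi hi'
      obtain ⟨k, hk⟩ := hi
      obtain ⟨l, hl⟩ := hi'
      rw [hk] at hl
      simp only [Sum.inl.injEq, Prod.mk.injEq] at hl
      exact hbd hl.1
    · rw [Finset.disjoint_left]
      intro i hi hi'
      simp only [mem_biUnion, mem_filter, mem_univ, true_and] at hi hi'
      obtain ⟨b, -, k, hk⟩ := hi
      rw [hk] at hi'
      simp at hi'
  have hpos : ∀ a ∈ A, ∀ b ∈ A, 0 < c a b → b ∉ S ∧ (a = b ∨ r a b) := by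
    intro a ha b _ h
    obtain ⟨i, hi⟩ := card_pos.1 h
    simp only [mem_filter, mem_univ, true_and] at hi
    obtain ⟨k, hk⟩ := hi
    rcases hψt a ha i with h | ⟨b', hb', h1, h2, l, hl⟩
    · rw [hk] at h; simp at h
    · rw [hk] at hl
      simp only [Sum.inl.injEq, Prod.mk.injEq] at hl
      rw [hl.1]
      exact ⟨h1, h2⟩
  refine ⟨c, g, hpos, fun a ha => ?_, fun a ha => ⟨?_, (hout a ha).le⟩⟩
  · change #{i : Fin M | ψ a i = .inr a} ≤ 1
    refine card_le_one.2 fun i hi k hk => ?_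
    simp only [mem_filter, mem_univ, true_and] at hi hk
    exact (hψ a ha a ha i k (hi.trans hk.symm)).2
  · rw [hout a ha]
    split_ifs with haS
    · rw [sum_eq_zero, zero_add]
      intro b hb
      by_contra h
      exact (hpos b hb a ha (Nat.pos_of_ne_zero h)).1 haS
    · rw [add_zero]
      have h1 : ∑ b ∈ A, c b a = #(A.sigma fun b => {i : Fin M | ∃ k, ψ b i = .inl (a, k)}) :=
        (card_sigma _ _).symm
      have h2 : ∀ x ∈ A.sigma fun b => {i : Fin M | ∃ k, ψ b i = .inl (a, k)},
          ∃ k, ψ x.1 x.2 = .inl (a, k) := fun x hx => (mem_filter.1 (mem_sigma.1 hx).2).2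
      have : Nonempty (Fin M) := ⟨⟨0, hM⟩⟩
      choose! κ hκ using h2
      rw [h1]
      refine (card_le_card_of_injOn κ (fun _ _ => mem_coe.2 (mem_univ _)) ?_).trans
        (card_univ.trans (Fintype.card_fin M)).le
      rintro ⟨b, i⟩ hx ⟨d, k⟩ hy hxy
      have h3 := hκ _ hx
      have h4 := hκ _ hy
      rw [← hxy] at h4
      obtain ⟨e1, e2⟩ := hψ b (mem_sigma.1 hx).1 d (mem_sigma.1 hy).1 i k (h3.trans h4.symm)
      rw [e1, e2]

/-- If every set of sources can emit `M` units each into its surroundings, where each vertex of `A`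
absorbs at most one unit and transmits at most `M` units, then this can be done within a set `Q` of
exactly `M * #S` vertices. The last clause is the resulting cut condition inside `Q`. -/
lemma exists_absorbing_set {V : Type*} [DecidableEq V] (r : V → V → Prop) [DecidableRel r]
    {A S : Finset V} (hSA : S ⊆ A) {M : ℕ} (hM : 0 < M)
    (hP : ∀ R ⊆ A,
      M * #(R ∩ S) ≤ M * #{b ∈ A | b ∉ R ∧ b ∉ S ∧ ∃ a ∈ R, r a b} + #R) :
    ∃ Q ⊆ A, S ⊆ Q ∧ #Q = M * #S ∧ ∀ R ⊆ Q, ∀ Z : Finset V,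
      (∀ x ∈ R, ∀ y ∈ Q, r x y → y ∈ R ∨ y ∈ Z) → M * #(R ∩ S) ≤ #R + M * #Z := by
  classical
  -- The factor 2 makes it profitable to trade one unit of flow for one unit of absorption.
  let cost : (V → V → ℕ) × (V → ℕ) → ℕ := fun p =>
    2 * (∑ a ∈ A, ∑ b ∈ A, p.1 a b) + ∑ a ∈ A, p.2 a
  obtain ⟨f₀, g₀, h₀⟩ := exists_isAbsorbingFlow r hM hP
  obtain ⟨⟨f, g⟩, hfl, hmin⟩ := (measure cost).wf.has_min
    {p | IsAbsorbingFlow r A S M p.1 p.2} ⟨(f₀, g₀), h₀⟩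
  obtain ⟨hf, hg, hfg⟩ := hfl
  dsimp only at hf hg hfg
  have hmin' : ∀ f' g', IsAbsorbingFlow r A S M f' g' → cost (f, g) ≤ cost (f', g') :=
    fun f' g' h => not_lt.1 (hmin (f', g') h)
  -- Removing one unit of flow from an arc.
  have hdec : ∀ a ∈ A, ∀ b ∈ A, 0 < f a b → ∃ f' : V → V → ℕ, (∀ x y, f' x y ≤ f x y) ∧
      (∀ x, x ≠ a → f' x = f x) ∧ ∑ y ∈ A, f' a y + 1 = ∑ y ∈ A, f a y ∧
      ∑ x ∈ A, ∑ y ∈ A, f' x y + 1 = ∑ x ∈ A, ∑ y ∈ A, f x y := by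
    intro a ha b hb hab
    have h1 : ∑ y ∈ A, (Function.update (f a) b (f a b - 1)) y + 1 = ∑ y ∈ A, f a y := by
      rw [sum_update_of_mem hb, ← add_sum_erase _ _ hb, sdiff_singleton_eq_erase]
      omega
    refine ⟨Function.update f a (Function.update (f a) b (f a b - 1)), fun x y => ?_, fun x hx => ?_,
      by rw [Function.update_self]; exact h1, ?_⟩
    · by_cases hx : x = a
      · subst hx
        rw [Function.update_self]
        by_cases hy : y = b
        · subst hy; rw [Function.update_self]; omega
        · rw [Function.update_of_ne hy]
      · rw [Function.update_of_ne hx]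
    · rw [Function.update_of_ne hx]
    · rw [← add_sum_erase _ _ ha, ← add_sum_erase _ (fun x => ∑ y ∈ A, f x y) ha, ← h1,
        Function.update_self]
      have : ∑ x ∈ A.erase a, ∑ y ∈ A, Function.update f a
          (Function.update (f a) b (f a b - 1)) x y = ∑ x ∈ A.erase a, ∑ y ∈ A, f x y :=
        sum_congr rfl fun x hx => by rw [Function.update_of_ne (ne_of_mem_erase hx)]
      rw [this]
      omega
  -- At a minimum nothing is created: any surplus could be cancelled on an outgoing arc or in the
  -- absorption.
  have hbal : ∀ a ∈ A,
      (∑ b ∈ A, f b a + if a ∈ S then M else 0) = ∑ b ∈ A, f a b + g a := by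
    intro a ha
    refine le_antisymm (hfg a ha).1 (not_lt.1 fun hlt => ?_)
    by_cases hga : g a = 0
    · have hsum : ∑ b ∈ A, f a b ≠ 0 := by omega
      obtain ⟨b, hb, hfb⟩ := exists_ne_zero_of_sum_ne_zero hsum
      obtain ⟨f', hle, hrow, hra, htot⟩ := hdec a ha b hb (Nat.pos_of_ne_zero hfb)
      have := hmin' f' g ⟨fun x hx y hy h => hf x hx y hy (h.trans_le (hle x y)), hg, fun x hx => by
        have hcol : ∑ y ∈ A, f' y x ≤ ∑ y ∈ A, f y x := sum_le_sum fun y _ => hle y x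
        have h3 := hfg x hx
        by_cases hxa : x = a
        · subst hxa; omega
        · rw [hrow x hxa]; omega⟩
      simp only [cost] at this
      omega
    · have := hmin' f (Function.update g a 0) ⟨hf, fun x hx => by
        by_cases hxa : x = a
        · subst hxa; simp
        · simpa [hxa] using hg x hx, fun x hx => by
        have h3 := hfg x hx
        have h4 := hg x hx
        by_cases hxa : x = a
        · subst hxa; rw [Function.update_self]; omega
        · rw [Function.update_of_ne hxa]; omega⟩
      simp only [cost] at this
      rw [sum_update_of_mem ha, ← add_sum_erase _ g ha, sdiff_singleton_eq_erase] at this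
      omega
  -- A vertex that is reached but does not absorb could keep one unit instead of sending it on, at
  -- lower cost.
  have habs : ∀ a ∈ A, 0 < (∑ b ∈ A, f b a + if a ∈ S then M else 0) → g a = 1 := by
    intro a ha hpos
    by_contra hga
    have hga : g a = 0 := by have := hg a ha; omega
    have hsum : ∑ b ∈ A, f a b ≠ 0 := by have := hbal a ha; omega
    obtain ⟨b, hb, hfb⟩ := exists_ne_zero_of_sum_ne_zero hsum
    obtain ⟨f', hle, hrow, hra, htot⟩ := hdec a ha b hb (Nat.pos_of_ne_zero hfb)
    have := hmin' f' (Function.update g a 1) ⟨fun x hx y hy h =>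
      hf x hx y hy (h.trans_le (hle x y)), fun x hx => by
        by_cases hxa : x = a
        · subst hxa; simp
        · simpa [hxa] using hg x hx, fun x hx => by
        have hcol : ∑ y ∈ A, f' y x ≤ ∑ y ∈ A, f y x := sum_le_sum fun y _ => hle y x
        have h3 := hfg x hx
        by_cases hxa : x = a
        · subst hxa; rw [Function.update_self]; omega
        · rw [hrow x hxa, Function.update_of_ne hxa]; omega⟩
    simp only [cost] at this
    rw [sum_update_of_mem ha, ← add_sum_erase _ g ha, sdiff_singleton_eq_erase] at this
    omega
  have hsrc : ∀ R : Finset V, (∑ a ∈ R, if a ∈ S then M else 0) = M * #(R ∩ S) := fun R => by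
    rw [← sum_filter, sum_const, smul_eq_mul, mul_comm, filter_mem_eq_inter]
  -- Summing the balance over `A` gives the cardinality; summing it over `R` gives the cut
  -- condition, since flow leaving `R` must enter `Z`, where each vertex receives at most `M` units.
  refine ⟨{a ∈ A | g a = 1}, filter_subset _ _, fun a ha => ?_, ?_, fun R hR Z hZ => ?_⟩
  · exact mem_filter.2 ⟨hSA ha, habs a (hSA ha) (by rw [if_pos ha]; omega)⟩
  · have h1 := sum_congr (rfl : A = A) hbal
    rw [sum_add_distrib, sum_add_distrib, sum_comm, hsrc, inter_eq_right.2 hSA] at h1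
    have h2 : ∑ a ∈ A, g a = #{a ∈ A | g a = 1} := by
      rw [card_filter]
      refine sum_congr rfl fun a ha => ?_
      have := hg a ha
      split_ifs <;> omega
    omega
  · have hRA : R ⊆ A := hR.trans (filter_subset _ _)
    have h1 := sum_congr (rfl : R = R) fun a ha => hbal a (hRA ha)
    rw [sum_add_distrib, sum_add_distrib, hsrc, sum_congr rfl fun x hx => (mem_filter.1 (hR hx)).2,
      ← card_eq_sum_ones] at h1
    have h2 : ∑ a ∈ R, ∑ b ∈ R, f b a ≤ ∑ a ∈ R, ∑ b ∈ A, f b a :=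
      sum_le_sum fun a _ => sum_le_sum_of_subset hRA
    have h3 : ∑ a ∈ R, ∑ b ∈ A, f a b ≤
        ∑ a ∈ R, ∑ b ∈ R, f a b + ∑ a ∈ R, ∑ b ∈ Z ∩ A, f a b := by
      rw [← sum_add_distrib]
      refine sum_le_sum fun a ha => ?_
      rw [← sum_union_inter]
      refine le_trans ?_ (Nat.le_add_right _ _)
      refine sum_le_sum_of_ne_zero fun b hb hab => ?_
      have hab' := Nat.pos_of_ne_zero hab
      rcases (hf a (hRA ha) b hb hab').2 with rfl | hr
      · exact mem_union_left _ ha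
      have hbQ : b ∈ ({a ∈ A | g a = 1} : Finset V) := by
        refine mem_filter.2 ⟨hb, habs b hb ?_⟩
        have := single_le_sum (f := fun x => f x b) (fun _ _ => Nat.zero_le _) (hRA ha)
        omega
      rcases hZ a ha b hbQ hr with h | h
      · exact mem_union_left _ h
      · exact mem_union_right _ (mem_inter.2 ⟨h, hb⟩)
    have h4 : ∑ a ∈ R, ∑ b ∈ Z ∩ A, f a b ≤ M * #Z := by
      calc ∑ a ∈ R, ∑ b ∈ Z ∩ A, f a b ≤ ∑ a ∈ A, ∑ b ∈ Z ∩ A, f a b := sum_le_sum_of_subset hRA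
        _ = ∑ b ∈ Z ∩ A, ∑ a ∈ A, f a b := sum_comm
        _ ≤ ∑ b ∈ Z ∩ A, M := sum_le_sum fun b hb => by
            have := hfg b (mem_inter.1 hb).2
            omega
        _ = #(Z ∩ A) * M := by rw [sum_const, smul_eq_mul]
        _ ≤ M * #Z := by
            rw [mul_comm]; exact Nat.mul_le_mul_left _ (card_le_card inter_subset_left)
    rw [sum_comm] at h2
    omega

/-! ### From the counting measure to arbitrary weights. -/

/-- If every subset of `K` can be separated by `s` vertices with respect to the counting measure,
then `K` can be separated by `9 * s` vertices with respect to any weight. -/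
theorem SimpleGraph.exists_separates_of_forall_card {V : Type*} {X : SimpleGraph V} {K : Finset V}
    {s : ℕ} (hs : 0 < s)
    (h : ∀ F ⊆ K, ∃ Z : Finset V, #Z ≤ s ∧ X.Separates F Z (fun _ => 1) #F)
    (w : V → ℕ) {W : ℕ} (hW : ∑ v ∈ K, w v ≤ W) :
    ∃ Z ⊆ K, #Z ≤ 9 * s ∧ X.Separates K Z w W := by
  classical
  by_contra hno
  have hheavy : ∀ Z ⊆ K, #Z ≤ 9 * s → ∃ C : Finset V, C ⊆ K ∧ Disjoint C Z ∧ X.ConnOn C ∧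
      W < 2 * ∑ v ∈ C, w v := by
    intro Z hZK hZs
    obtain ⟨C, h1, h2, h3, h4, -⟩ := exists_heavy_component fun h' => hno ⟨Z, hZK, hZs, h'⟩
    exact ⟨C, h1, h2, h3, h4⟩
  have hmeet : ∀ C D : Finset V, C ⊆ K → D ⊆ K → W < 2 * ∑ v ∈ C, w v → W < 2 * ∑ v ∈ D, w v →
      ¬ Disjoint C D := by
    intro C D hC hD hCW hDW hdis
    have h1 := sum_le_sum_of_subset (f := w) (union_subset hC hD)
    rw [sum_union hdis] at h1
    omega
  let bd : Finset V → Finset V := fun D => {y ∈ K | y ∉ D ∧ ∃ x ∈ D, X.Adj x y}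
  -- The last `M` at which `P` persists is wanted: `P M` bounds the minimal cost below by `4 * s *
  -- M`, and failure of `P (M + 1)` bounds it above by `4 * s * (M + 1)`.
  let P : ℕ → Prop := fun M => ∀ D ⊆ K, W < 2 * ∑ v ∈ D, w v → 4 * s * M < #D + M * #(bd D)
  have hP1 : P 1 := by
    intro D hDK hDW
    by_contra hlt
    obtain ⟨C, hCK, hdis, -, hCW⟩ := hheavy D hDK (by omega)
    exact hmeet C D hCK hDK hCW hDW hdis
  have hPK : ¬ P (#K + 1) := by
    intro hP
    obtain ⟨C, hCK, -, -, hCW⟩ := hheavy ∅ (empty_subset _) (by simp)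
    have h1 := hP K subset_rfl (hCW.trans_le (Nat.mul_le_mul_left _ (sum_le_sum_of_subset hCK)))
    have h2 : bd K = ∅ := filter_eq_empty_iff.2 fun y hy h' => h'.1 hy
    rw [h2, card_empty] at h1
    nlinarith
  obtain ⟨M, hM, hPM, hPM'⟩ : ∃ M, 1 ≤ M ∧ P M ∧ ¬ P (M + 1) := by
    by_contra hcon
    push Not at hcon
    exact hPK (Nat.le_induction hP1 (fun n hn ih => hcon n hn ih) (#K + 1) (by omega))
  simp only [P, not_forall, not_lt] at hPM'
  obtain ⟨D₁, hD₁K, hD₁W, hD₁⟩ := hPM'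
  obtain ⟨D, hD, hmin⟩ := exists_min_image
    (K.powerset.filter fun D => W < 2 * ∑ v ∈ D, w v) (fun D => #D + M * #(bd D))
    ⟨D₁, by simp [hD₁K, hD₁W]⟩
  simp only [mem_filter, mem_powerset, and_imp] at hD hmin
  obtain ⟨hDK, hDW⟩ := hD
  have hDne : ∀ R : Finset V, D ⊆ R → W < 2 * ∑ v ∈ R, w v := fun R hR =>
    hDW.trans_le (Nat.mul_le_mul_left _ (sum_le_sum_of_subset hR))
  -- `M * #(bd D)` is at most `4 * s * (M + 1) ≤ 8 * s * M`. Together with a counting separator of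
  -- size `s` this accounts for the constant 9.
  have hSs : #(bd D) ≤ 8 * s := by
    have h1 := hmin D₁ hD₁K hD₁W
    refine Nat.le_of_mul_le_mul_left ?_ hM
    nlinarith [Nat.mul_le_mul_left s hM]
  have hSK : bd D ⊆ K := filter_subset _ _
  -- The hypothesis of the flow lemma is the minimality of `D` compared with `D ∪ R`.
  obtain ⟨Q, hQA, hSQ, hQ, hQcut⟩ := exists_absorbing_set X.Adj (A := K \ D) (S := bd D)
    (fun x hx => mem_sdiff.2 ⟨hSK hx, (mem_filter.1 hx).2.1⟩) hM (by
      intro R hR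
      have hRK : R ⊆ K := hR.trans sdiff_subset
      have h1 := hmin (D ∪ R) (union_subset hDK hRK) (hDne _ subset_union_left)
      have h2 : bd (D ∪ R) ⊆ (bd D \ R) ∪
          {b ∈ K \ D | b ∉ R ∧ b ∉ bd D ∧ ∃ a ∈ R, X.Adj a b} := by
        intro y hy
        obtain ⟨hyK, hyDR, x, hx, hxy⟩ := mem_filter.1 hy
        rw [mem_union, not_or] at hyDR
        by_cases hyb : y ∈ bd D
        · exact mem_union_left _ (mem_sdiff.2 ⟨hyb, hyDR.2⟩)
        · refine mem_union_right _ (mem_filter.2 ⟨mem_sdiff.2 ⟨hyK, hyDR.1⟩, hyDR.2, hyb, x, ?_, hxy⟩)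
          refine (mem_union.1 hx).resolve_left fun hxD => hyb ?_
          exact mem_filter.2 ⟨hyK, hyDR.1, x, hxD, hxy⟩
      have h3 := Nat.mul_le_mul_left M ((card_le_card h2).trans (card_union_le _ _))
      have h4 := card_union_le D R
      have h5 := congrArg (M * ·) (card_sdiff_add_card_inter (bd D) R)
      simp only [mul_add] at h3 h5
      rw [inter_comm R]
      omega)
  have hQK : Q ⊆ K := hQA.trans sdiff_subset
  obtain ⟨Z, hZs, hZ⟩ := h (D ∪ Q) (union_subset hDK hQK)
  obtain ⟨D', hD'K, hD'dis, hD'conn, hD'W⟩ := hheavy ((Z ∪ bd D) ∩ K) inter_subset_right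
    ((card_le_card inter_subset_left).trans ((card_union_le _ _).trans (by omega)))
  have hD'not : ∀ x ∈ D', x ∉ Z ∧ x ∉ bd D := by
    intro x hx
    have := Finset.disjoint_left.1 hD'dis hx
    simp only [mem_inter, mem_union, hD'K hx, and_true, not_or] at this
    exact this
  have hD'D : D' ⊆ D := by
    have hn := hmeet D' D hD'K hDK hD'W hDW
    rw [Finset.not_disjoint_iff] at hn
    obtain ⟨x, hx, hxD⟩ := hn
    refine coe_subset.1 (hD'conn D ⟨x, hx, hxD⟩ ?_)
    rintro u ⟨hu, huD⟩ v hv huv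
    by_contra hvD
    exact (hD'not v hv).2 (mem_filter.2 ⟨hD'K hv, hvD, u, huD, huv⟩)
  obtain ⟨C, hD'C, hCF, hCconn, hCcl⟩ := hD'conn.exists_component (L := (D ∪ Q) \ Z)
    fun x hx => mem_sdiff.2 ⟨mem_union_left _ (hD'D hx), (hD'not x hx).1⟩
  have hCcl' : ∀ x ∈ C, ∀ y ∈ D ∪ Q, X.Adj x y → y ∈ C ∨ y ∈ Z := by
    intro x hx y hy hxy
    by_cases hyZ : y ∈ Z
    · exact .inr hyZ
    · exact .inl (hCcl x hx y (mem_sdiff.2 ⟨hy, hyZ⟩) hxy)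
  have hCbal := hZ C (hCF.trans sdiff_subset)
    (Finset.disjoint_left.2 fun x hx => (mem_sdiff.1 (hCF hx)).2) hCconn
  rw [sum_const, smul_eq_mul, mul_one] at hCbal
  -- `C ∩ D` is heavy, so it costs at least as much as `D`. Bounding its boundary by `Z` and `C ∩ bd
  -- D`, and the latter by the flow, gives `#(D ∪ Q) ≤ #C + 2 * M * #Z`. As `C` has at most half of
  -- `D ∪ Q`, this forces `#(D ∪ Q) ≤ 4 * s * M`, against `P M`.
  have hCD := hmin (C ∩ D) (inter_subset_right.trans hDK) (hD'W.trans_le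
    (Nat.mul_le_mul_left _ (sum_le_sum_of_subset (subset_inter hD'C hD'D))))
  have hbdCD : bd (C ∩ D) ⊆ Z ∪ (C ∩ bd D) := by
    intro y hy
    obtain ⟨hyK, hyCD, x, hx, hxy⟩ := mem_filter.1 hy
    rw [mem_inter] at hx
    have hyb : y ∉ D → y ∈ bd D := fun hyD => mem_filter.2 ⟨hyK, hyD, x, hx.2, hxy⟩
    have hyF : y ∈ D ∪ Q := by
      by_cases hyD : y ∈ D
      · exact mem_union_left _ hyD
      · exact mem_union_right _ (hSQ (hyb hyD))
    rcases hCcl' x hx.1 y hyF hxy with hyC | hyZ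
    · exact mem_union_right _ (mem_inter.2 ⟨hyC, hyb fun hyD => hyCD (mem_inter.2 ⟨hyC, hyD⟩)⟩)
    · exact mem_union_left _ hyZ
  have hCQ := hQcut (C ∩ Q) inter_subset_right Z (by
    intro x hx y hy hxy
    rcases hCcl' x (mem_inter.1 hx).1 y (mem_union_right _ hy) hxy with h' | h'
    · exact .inl (mem_inter.2 ⟨h', hy⟩)
    · exact .inr h')
  rw [inter_assoc, inter_eq_right.2 hSQ] at hCQ
  have hDQ : Disjoint D Q := Finset.disjoint_left.2 fun x hx hxQ => (mem_sdiff.1 (hQA hxQ)).2 hx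
  have hCcard : #(C ∩ D) + #(C ∩ Q) ≤ #C := by
    rw [← card_union_of_disjoint (hDQ.mono inter_subset_right inter_subset_right)]
    exact card_le_card (union_subset inter_subset_left inter_subset_left)
  have h1 := Nat.mul_le_mul_left M ((card_le_card hbdCD).trans (card_union_le _ _))
  have h2 := hPM D hDK hDW
  have h3 := Nat.mul_le_mul_left M hZs
  rw [card_union_of_disjoint hDQ, hQ] at hCbal
  rw [mul_add] at h1
  have h4 : 4 * s * M = 4 * (M * s) := by ring
  omega

/-- The separation profile controls separators for arbitrary weights. -/
lemma SimpleGraph.exists_separates_weight {V : Type*} {X : SimpleGraph V} {K : Finset V} {r : ℕ}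
    (hK : #K ≤ r) (w : V → ℕ) {W : ℕ} (hW : ∑ v ∈ K, w v ≤ W) :
    ∃ Z ⊆ K, #Z ≤ 9 * (X.sepProfile r + 1) ∧ X.Separates K Z w W := by
  refine exists_separates_of_forall_card (Nat.succ_pos _) (fun F hF => ?_) w hW
  obtain ⟨Z, hZ, hZ'⟩ := exists_separates_card (X := X) ((card_le_card hF).trans hK)
  exact ⟨Z, hZ.trans (Nat.le_succ _), hZ'⟩

/-! ### Monotonicity under injective homomorphisms. -/

section Comparison

variable {P P' : Type*} [Group P] [Group P']

lemma SimpleGraph.ConnOn.mul_left {U : Set P} {C : Set P} (hC : (mulCayley U).ConnOn C) (g : P) :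
    (mulCayley U).ConnOn ((g * ·) '' C) :=
  hC.image fun _ _ _ _ h => .inr (mulCayley_adj_mul_iff_right.2 h)

lemma exists_connOn_one_mem {U : Finset P} (hU : IsFiniteGenSet U) (g : P) :
    ∃ B : Set P, B.Finite ∧ 1 ∈ B ∧ g ∈ B ∧ (SimpleGraph.mulCayley (U : Set P)).ConnOn B := by
  have hg : g ∈ Subgroup.closure (U : Set P) := by rw [hU]; trivial
  induction hg using Subgroup.closure_induction with
  | mem u hu =>
    refine ⟨{1} ∪ {u}, (Set.finite_singleton _).union (Set.finite_singleton _), .inl rfl, .inr rfl,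
      (SimpleGraph.connOn_singleton 1).union (SimpleGraph.connOn_singleton u)
        ⟨1, rfl, u, rfl, ?_⟩⟩
    by_cases h : 1 = u
    · exact .inl h
    · exact .inr ((SimpleGraph.mulCayley_adj _ _ _).2 ⟨h, .inl (by simpa using hu)⟩)
  | one => exact ⟨{1}, Set.finite_singleton _, rfl, rfl, SimpleGraph.connOn_singleton 1⟩
  | mul x y _ _ hx hy =>
    obtain ⟨B, hB, hB1, hBx, hBc⟩ := hx
    obtain ⟨B', hB', hB'1, hB'y, hB'c⟩ := hy
    exact ⟨B ∪ (x * ·) '' B', hB.union (hB'.image _), .inl hB1, .inr ⟨y, hB'y, rfl⟩,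
      hBc.union (hB'c.mul_left x) ⟨x, hBx, x, ⟨1, hB'1, mul_one x⟩, .inl rfl⟩⟩
  | inv x _ hx =>
    obtain ⟨B, hB, hB1, hBx, hBc⟩ := hx
    exact ⟨(x⁻¹ * ·) '' B, hB.image _, ⟨x, hBx, inv_mul_cancel x⟩, ⟨1, hB1, mul_one _⟩,
      hBc.mul_left x⁻¹⟩

/-- Every finite subset of a finitely generated group lies in a finite connected set. -/
lemma exists_connOn_subset {U : Finset P} (hU : IsFiniteGenSet U) (E : Finset P) :
    ∃ B : Set P, B.Finite ∧ 1 ∈ B ∧ (E : Set P) ⊆ B ∧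
      (SimpleGraph.mulCayley (U : Set P)).ConnOn B := by
  classical
  induction E using Finset.induction with
  | empty =>
    exact ⟨{1}, Set.finite_singleton _, rfl, by simp, SimpleGraph.connOn_singleton 1⟩
  | insert g E _ ih =>
    obtain ⟨B, hB, hB1, hBE, hBc⟩ := ih
    obtain ⟨B', hB', hB'1, hB'g, hB'c⟩ := exists_connOn_one_mem hU g
    refine ⟨B ∪ B', hB.union hB', .inl hB1, ?_, hBc.union hB'c ⟨1, hB1, 1, hB'1, .inl rfl⟩⟩
    rw [coe_insert, Set.insert_subset_iff]
    exact ⟨.inr hB'g, hBE.trans Set.subset_union_left⟩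

/-- Separation profiles do not decrease under injective homomorphisms. -/
theorem groupSep_coarseLE_of_injective (f : P →* P') (hf : Function.Injective f) (S : Finset P)
    {U : Finset P'} (hU : IsFiniteGenSet U) : CoarseLE (groupSep S) (groupSep U) := by
  classical
  obtain ⟨B₀, hfin, h1, hS, hconn⟩ := exists_connOn_subset hU (S.image f)
  lift B₀ to Finset P' using hfin
  rename' B₀ => B
  have hB1 : 1 ≤ #B := card_pos.2 ⟨1, h1⟩
  refine ⟨9 * #B, fun r => ?_⟩
  have key : groupSep S r ≤ #B * (9 * (groupSep U (9 * #B * r) + 1)) := by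
    refine SimpleGraph.sepProfile_le fun K hK => ?_
    -- Adjacent points have intersecting stars, so a connected set has a connected union of stars.
    let star : P → Finset P' := fun x => B.image (f x * ·)
    have hself : ∀ x, f x ∈ star x := fun x => mem_image.2 ⟨1, h1, mul_one _⟩
    have hK' : #(K.biUnion star) ≤ 9 * #B * r := by
      calc #(K.biUnion star) ≤ #K * #B := card_biUnion_le_card_mul _ _ _ fun x _ => card_image_le
        _ ≤ r * #B := Nat.mul_le_mul_right _ hK
        _ ≤ 9 * #B * r := by nlinarith [Nat.zero_le (#B * r)]
    -- Halving the thickened set by counting would say nothing about `K`; the weight counts only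
    -- points of `f(K)`.
    let w : P' → ℕ := fun y => if y ∈ K.image f then 1 else 0
    have hw : ∀ L : Finset P', ∑ y ∈ L, w y = #(L ∩ K.image f) := fun L => by
      rw [sum_ite_mem, sum_const, smul_eq_mul, mul_one]
    obtain ⟨Z, -, hZc, hZ⟩ := SimpleGraph.exists_separates_weight
      (X := SimpleGraph.mulCayley (U : Set P')) hK' w (W := #K)
      (by rw [hw]; exact (card_le_card inter_subset_right).trans card_image_le)
    -- Each point of `Z` lies in at most `#B` stars, because `f` is injective.
    refine ⟨{x ∈ K | ∃ z ∈ Z, z ∈ star x}, ?_, fun C hCK hCZ hC => ?_⟩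
    · have hsub : (({x ∈ K | ∃ z ∈ Z, z ∈ star x} : Finset P).image f) ⊆
          Z.biUnion fun z => B.image (z * ·⁻¹) := by
        intro y hy
        obtain ⟨x, hx, rfl⟩ := mem_image.1 hy
        obtain ⟨-, z, hz, hzx⟩ := mem_filter.1 hx
        obtain ⟨b, hb, rfl⟩ := mem_image.1 hzx
        exact mem_biUnion.2 ⟨_, hz, mem_image.2 ⟨b, hb, by simp⟩⟩
      rw [← card_image_of_injective _ hf]
      refine (card_le_card hsub).trans
        ((card_biUnion_le_card_mul _ _ _ fun _ _ => card_image_le).trans ?_)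
      rw [mul_comm]
      exact Nat.mul_le_mul_left _ hZc
    · have hdis : Disjoint (C.biUnion star) Z := by
        rw [Finset.disjoint_left]
        intro y hy hyZ
        obtain ⟨x, hx, hyx⟩ := mem_biUnion.1 hy
        exact Finset.disjoint_left.1 hCZ hx (mem_filter.2 ⟨hCK hx, y, hyZ, hyx⟩)
      have h2 := hZ (C.biUnion star) (biUnion_subset_biUnion_of_subset_left _ hCK) hdis (by
        rw [coe_biUnion]
        refine hC.biUnion (fun x _ => ?_) fun x _ y _ hxy => ?_
        · rw [coe_image]; exact hconn.mul_left (f x)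
        · have hmem : ∀ u v : P, u⁻¹ * v ∈ S → f v ∈ star u := fun u v huv =>
            mem_image.2 ⟨f (u⁻¹ * v), hS (mem_coe.2 (mem_image_of_mem f huv)), by simp⟩
          rcases ((SimpleGraph.mulCayley_adj _ _ _).1 hxy).2 with h | h
          · exact ⟨f y, hmem x y h, hself y⟩
          · exact ⟨f x, hself x, hmem y x h⟩)
      refine le_trans ?_ h2
      rw [hw, sum_const, smul_eq_mul, mul_one, ← card_image_of_injective C hf]
      refine Nat.mul_le_mul_left _ (card_le_card fun y hy => ?_)
      obtain ⟨x, hx, rfl⟩ := mem_image.1 hy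
      exact mem_inter.2 ⟨mem_biUnion.2 ⟨x, hx, hself x⟩, mem_image_of_mem f (hCK hx)⟩
  refine key.trans (le_of_eq ?_)
  ring

end Comparison

/-! ### First letters of reduced words. -/

namespace Monoid.CoprodI

variable {ι : Type*} {M : ι → Type*} [∀ i, Group (M i)]

open scoped Classical in
/-- The first letter of the reduced word of `x` if it lies in `M i`, and `1` otherwise. -/
noncomputable def head (i : ι) (x : CoprodI M) : M i :=
  (Word.equivPair i (Word.equiv x)).head

lemma head_one (i : ι) : head i (1 : CoprodI M) = 1 := by
  classical
  have h : Word.equiv (1 : CoprodI M) = Word.empty := by simp [Word.equiv]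
  rw [head, h, Word.equivPair_eq_of_fstIdx_ne]
  simp [Word.fstIdx, Word.empty]

lemma head_of_mul {i : ι} (m : M i) (x : CoprodI M) : head i (of m * x) = m * head i x := by
  classical
  have h : Word.equiv (of m * x) = of m • Word.equiv x := by simp [Word.equiv, mul_smul]
  simp only [head, h, Word.equivPair_smul_same]

@[simp]
lemma head_of {i : ι} (m : M i) : head i (of m) = m := by
  simpa [head_one] using head_of_mul m 1

lemma head_eq_one_of_ne {i j : ι} (hij : i ≠ j) {x : CoprodI M} (h : head i x ≠ 1) :
    head j x = 1 := by
  classical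
  have hi : (Word.equiv x).fstIdx = some i := by
    by_contra hne
    exact h (by rw [head, Word.equivPair_eq_of_fstIdx_ne hne])
  rw [head, Word.equivPair_eq_of_fstIdx_ne]
  rw [hi]
  simpa using hij

lemma head_of_of_ne {i j : ι} (hij : i ≠ j) (m : M j) : head i (of m : CoprodI M) = 1 := by
  by_cases hm : m = 1
  · rw [hm, map_one, head_one]
  · exact head_eq_one_of_ne hij.symm (by rwa [head_of])

lemma exists_head_ne_one {x : CoprodI M} (hx : x ≠ 1) : ∃ i, head i x ≠ 1 := by
  classical
  obtain ⟨w, rfl⟩ := Word.equiv.symm.surjective x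
  induction w using Word.consRecOn with
  | empty => exact absurd (by simp [Word.equiv]) hx
  | cons i m w h1 h2 _ =>
    refine ⟨i, ?_⟩
    have h : Word.equiv.symm (Word.cons m w h1 h2) = of m * w.prod := Word.prod_cons _ _ _ h2 h1
    have h' : Word.equiv w.prod = w := Word.equiv.apply_symm_apply w
    rw [h, head_of_mul, head, h', Word.equivPair_eq_of_fstIdx_ne h1, mul_one]
    exact h2

/-- Multiplication by `M j` on the right changes the first letter of one-letter words only. -/
lemma head_mul_of (x : CoprodI M) {j : ι} (m : M j) (i : ι) :
    head i (x * of m) = head i x ∨ (i = j ∧ ∃ g : M i, x = of g) := by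
  classical
  obtain ⟨w, rfl⟩ := Word.equiv.symm.surjective x
  induction w using Word.consRecOn generalizing i with
  | empty =>
    have h : Word.equiv.symm (Word.empty : Word M) = 1 := by simp [Word.equiv]
    rw [h, one_mul, head_one]
    by_cases hij : i = j
    · exact .inr ⟨hij, 1, (map_one _).symm⟩
    · exact .inl (head_of_of_ne hij m)
  | cons k g w h1 h2 ih =>
    have h : Word.equiv.symm (Word.cons g w h1 h2) = of g * Word.equiv.symm w :=
      Word.prod_cons _ _ _ h2 h1
    have h' : head k (Word.equiv.symm w) = 1 := by
      rw [head, Word.equiv.apply_symm_apply, Word.equivPair_eq_of_fstIdx_ne h1]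
    rw [h, mul_assoc]
    by_cases hik : i = k
    · subst hik
      rcases ih i with hw | ⟨rfl, g', hg'⟩
      · left; rw [head_of_mul, head_of_mul, hw]
      · exact .inr ⟨rfl, g * g', by rw [hg', map_mul]⟩
    · left
      rw [head_eq_one_of_ne (Ne.symm hik) (x := of g * Word.equiv.symm w)
        (by rwa [head_of_mul, h', mul_one])]
      rcases ih k with hw | ⟨rfl, g', hg'⟩
      · exact head_eq_one_of_ne (Ne.symm hik) (by rwa [head_of_mul, hw, h', mul_one])
      · rw [hg', ← map_mul, ← map_mul, head_of_of_ne hik]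

end Monoid.CoprodI

/-! ### Separators in free products. -/

namespace Monoid.CoprodI

variable {ι : Type*} {M : ι → Type*} [∀ i, Group (M i)]

/-- In the Cayley graph of a free product, the projection to the coset `v * M i` is constant along
edges outside that coset. -/
lemma head_eq_or_of_adj {S : ∀ i, Finset (M i)} {U : Set (CoprodI M)}
    (hU : ∀ u ∈ U, ∃ i, ∃ s ∈ S i, u = of s) (v : CoprodI M) (i : ι) {x y : CoprodI M}
    (hxy : (SimpleGraph.mulCayley U).Adj x y) :
    head i (v⁻¹ * x) = head i (v⁻¹ * y) ∨ ∃ a b : M i, x = v * of a ∧ y = v * of b ∧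
      (SimpleGraph.mulCayley (S i : Set (M i))).Adj a b := by
  have key : ∀ x y : CoprodI M, x ≠ y → x⁻¹ * y ∈ U → head i (v⁻¹ * x) = head i (v⁻¹ * y) ∨
      ∃ a b : M i, x = v * of a ∧ y = v * of b ∧
        (SimpleGraph.mulCayley (S i : Set (M i))).Adj a b := by
    intro x y hne hu
    obtain ⟨j, s, hs, hxs⟩ := hU _ hu
    have hy : y = x * of s := by rw [← hxs]; group
    rcases head_mul_of (v⁻¹ * x) s i with h | ⟨rfl, g, hg⟩
    · left; rw [← h, hy, mul_assoc]
    · right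
      have hx : x = v * of g := by rw [← hg]; group
      refine ⟨g, g * s, hx, by rw [hy, hx, map_mul, mul_assoc],
        (SimpleGraph.mulCayley_adj _ _ _).2 ⟨fun h => hne ?_, .inl (by simpa using hs)⟩⟩
      rw [hy, left_eq_mul.1 h, map_one, mul_one]
  obtain ⟨hne, h | h⟩ := (SimpleGraph.mulCayley_adj _ _ _).1 hxy
  · exact key x y hne h
  · rcases key y x hne.symm h with h | ⟨a, b, ha, hb, hab⟩
    · exact .inl h.symm
    · exact .inr ⟨b, a, hb, ha, hab.symm⟩

/-- Finite subsets of a free product are separated as cheaply as those of its factors. -/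
theorem exists_separates {S : ∀ i, Finset (M i)} {U : Set (CoprodI M)}
    (hU : ∀ u ∈ U, ∃ i, ∃ s ∈ S i, u = of s) {K : Finset (CoprodI M)} {n m : ℕ} (hK : #K ≤ n)
    (hm : ∀ i, groupSep (S i) n ≤ m) (w : CoprodI M → ℕ) {W : ℕ} (hW : ∑ v ∈ K, w v ≤ W) :
    ∃ Z : Finset (CoprodI M), #Z ≤ 9 * (m + 1) ∧
      (SimpleGraph.mulCayley U).Separates K Z w W := by
  classical
  by_contra hno
  push Not at hno
  have hmeet : ∀ C ⊆ K, ∀ D ⊆ K, W < 2 * ∑ v ∈ C, w v → W < 2 * ∑ v ∈ D, w v →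
      ¬ Disjoint C D := by
    intro C hC D hD hCW hDW hdis
    have h1 := sum_le_sum_of_subset (f := w) (union_subset hC hD)
    rw [sum_union hdis] at h1
    omega
  have hnonempty : ∀ C : Finset (CoprodI M), W < 2 * ∑ v ∈ C, w v → C.Nonempty := by
    intro C hC
    rw [nonempty_iff_ne_empty]
    rintro rfl
    simp at hC
  -- A connected set that avoids `v * g` lies over `g` as soon as one of its points does.
  have hfiber : ∀ (v : CoprodI M) (i : ι) (C : Finset (CoprodI M)),
      (SimpleGraph.mulCayley U).ConnOn C → ∀ x ∈ C, v * of (head i (v⁻¹ * x)) ∉ C →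
      ∀ y ∈ C, head i (v⁻¹ * y) = head i (v⁻¹ * x) := by
    intro v i C hC x hx hv
    refine hC {y | head i (v⁻¹ * y) = head i (v⁻¹ * x)} ⟨x, hx, rfl⟩ ?_
    rintro y ⟨hy, hyx⟩ z - hyz
    rw [Set.mem_ofPred_eq] at hyx ⊢
    rcases head_eq_or_of_adj hU v i hyz with h | ⟨a, b, ha, -, -⟩
    · rw [← h, hyx]
    · refine absurd ?_ hv
      have : head i (v⁻¹ * y) = a := by rw [ha, inv_mul_cancel_left, head_of]
      rw [← hyx, this, ← ha]
      exact hy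
  obtain ⟨K₀, hK₀K, -, hK₀, hK₀W, hK₀cl⟩ :=
    SimpleGraph.exists_heavy_component (hno ∅ (by simp))
  have hsubK₀ : ∀ C : Finset (CoprodI M), C ⊆ K → (SimpleGraph.mulCayley U).ConnOn C →
      W < 2 * ∑ v ∈ C, w v → C ⊆ K₀ := by
    intro C hCK hC hCW
    have hn := hmeet C hCK K₀ hK₀K hCW hK₀W
    rw [Finset.not_disjoint_iff] at hn
    obtain ⟨x, hx, hx₀⟩ := hn
    refine coe_subset.1 (hC K₀ ⟨x, hx, hx₀⟩ ?_)
    rintro u ⟨-, hu⟩ v hv huv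
    exact (hK₀cl u hu v (hCK hv) huv).resolve_right (notMem_empty _)
  -- The fibre over `1` can be entered or left only through `v`, so a connected set missing `v`
  -- stays within one side.
  let side : CoprodI M → ι → Finset (CoprodI M) := fun v i => {x ∈ K | head i (v⁻¹ * x) ≠ 1}
  have hside : ∀ v, ∀ C ⊆ K, v ∉ C → (SimpleGraph.mulCayley U).ConnOn C →
      W < 2 * ∑ x ∈ C, w x → ∃ i, C ⊆ side v i := by
    intro v C hCK hvC hC hCW
    obtain ⟨x, hx⟩ := hnonempty C hCW
    obtain ⟨i, hi⟩ := exists_head_ne_one (x := v⁻¹ * x) fun h => hvC (by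
      rwa [inv_mul_eq_one.1 h])
    refine ⟨i, fun y hy => mem_filter.2 ⟨hCK hy, fun hy1 => hi ?_⟩⟩
    have := hfiber v i C hC y hy (by rwa [hy1, map_one, mul_one]) x hx
    rw [this, hy1]
  let Heavy : CoprodI M × ι → Prop := fun p => p.1 ∈ K₀ ∧ W < 2 * ∑ x ∈ side p.1 p.2, w x
  have hexists : ∃ p, Heavy p := by
    obtain ⟨v, hv⟩ := hnonempty K₀ hK₀W
    obtain ⟨C, hCK, hdis, hC, hCW, -⟩ := SimpleGraph.exists_heavy_component
      (hno {v} (by rw [card_singleton]; omega))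
    obtain ⟨i, hi⟩ := hside v C hCK (by simpa using hdis) hC hCW
    exact ⟨(v, i), hv, hCW.trans_le (Nat.mul_le_mul_left _ (sum_le_sum_of_subset hi))⟩
  obtain ⟨⟨v, i⟩, ⟨hv, hviW⟩, hmin⟩ :=
    (measure fun p : CoprodI M × ι => #(side p.1 p.2)).wf.has_min {p | Heavy p} hexists
  dsimp only at hv hviW
  have hpoint : ∀ g : M i, v * of g ∈ K₀ → ∀ C ⊆ K, v * of g ∉ C →
      (SimpleGraph.mulCayley U).ConnOn C → W < 2 * ∑ x ∈ C, w x → C ⊆ side (v * of g) i := by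
    intro g hg C hCK hgC hC hCW
    obtain ⟨k, hk⟩ := hside _ C hCK hgC hC hCW
    have hkW := hCW.trans_le (Nat.mul_le_mul_left _ (sum_le_sum_of_subset hk))
    by_cases hki : k = i
    · rwa [hki] at hk
    exfalso
    have hhead : ∀ x ∈ side (v * of g) k, head i (v⁻¹ * x) = g := by
      intro x hx
      have h1 := head_eq_one_of_ne hki (mem_filter.1 hx).2
      have h2 : v⁻¹ * x = of g * ((v * of g)⁻¹ * x) := by group
      rw [h2, head_of_mul, h1, mul_one]
    -- A heavy side of `v * of g` in another direction `k` lies over `g`. If `g = 1` it is disjoint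
    -- from the heavy side of `v`; otherwise it is strictly smaller than that side, as it omits `v *
    -- of g`.
    by_cases hg1 : g = 1
    · refine hmeet _ (filter_subset _ _) _ (filter_subset _ _) hkW hviW ?_
      rw [Finset.disjoint_left]
      intro x hx hx'
      exact (mem_filter.1 hx').2 ((hhead x hx).trans hg1)
    · refine hmin (v * of g, k) ⟨hg, hkW⟩ (card_lt_card ?_)
      refine (ssubset_iff_of_subset fun x hx => ?_).2 ⟨v * of g, ?_, ?_⟩
      · exact mem_filter.2 ⟨(mem_filter.1 hx).1, by rw [hhead x hx]; exact hg1⟩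
      · exact mem_filter.2 ⟨hK₀K hg, by rwa [inv_mul_cancel_left, head_of]⟩
      · intro h
        exact (mem_filter.1 h).2 (by rw [inv_mul_cancel, head_one])
  let π : CoprodI M → M i := fun x => head i (v⁻¹ * x)
  have hπ : ∀ g : M i, π (v * of g) = g := fun g => by simp [π]
  have hinj : Function.Injective fun g : M i => v * of g := fun a b h => by
    rw [← hπ a, ← hπ b]; exact congrArg π h
  let L : Finset (M i) := K₀.preimage (fun g => v * of g) hinj.injOn
  have hL : #L ≤ n := by
    rw [← card_image_of_injective L hinj]
    refine (card_le_card ?_).trans ((card_le_card hK₀K).trans hK)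
    intro x hx
    obtain ⟨g, hg, rfl⟩ := mem_image.1 hx
    exact (mem_preimage (f := fun g : M i => v * of g)).1 hg
  have hsumπ : ∀ t : Finset (M i), ∑ g ∈ t, ∑ x ∈ K with π x = g, w x =
      ∑ x ∈ K with π x ∈ t, w x := fun t => sum_fiberwise_eq_sum_filter K t π w
  obtain ⟨Z, -, hZc, hZ⟩ := SimpleGraph.exists_separates_weight
    (X := SimpleGraph.mulCayley (S i : Set (M i))) hL (fun g => ∑ x ∈ K with π x = g, w x) (W := W)
    (by
      rw [hsumπ]
      exact (sum_le_sum_of_subset (filter_subset _ _)).trans hW)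
  have hZc' : #(Z.image fun g => v * of g) ≤ 9 * (m + 1) :=
    card_image_le.trans (hZc.trans (Nat.mul_le_mul_left _ (Nat.succ_le_succ (hm i))))
  obtain ⟨C, hCK, hdis, hC, hCW, -⟩ := SimpleGraph.exists_heavy_component (hno _ hZc')
  have hCK₀ := hsubK₀ C hCK hC hCW
  -- Otherwise `C` lies over the single point `π x`. The corresponding coset point is in `K₀`: if
  -- not, `K₀` would lie over `π x` too, and `v ∈ K₀` would give `π x = 1`. Then `hpoint` places `C`
  -- in a side that does not contain `x`.
  have hmem : ∀ x ∈ C, v * of (π x) ∈ C := by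
    intro x hx
    by_contra hxC
    have hcst := hfiber v i C hC x hx hxC
    have hxK₀ : v * of (π x) ∈ K₀ := by
      by_contra h
      have h1 := hfiber v i K₀ hK₀ x (hCK₀ hx) h v hv
      rw [inv_mul_cancel, head_one] at h1
      apply h
      change v * of (head i (v⁻¹ * x)) ∈ K₀
      rwa [← h1, map_one, mul_one]
    refine (mem_filter.1 (hpoint (π x) hxK₀ C hCK hxC hC hCW hx)).2 ?_
    have h2 : (v * of (π x))⁻¹ * x = of (π x)⁻¹ * (v⁻¹ * x) := by rw [map_inv]; group
    rw [h2, head_of_mul]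
    exact inv_mul_cancel _
  have hsum := hZ (C.image π)
    (fun g hg => by
      obtain ⟨x, hx, rfl⟩ := mem_image.1 hg
      exact (mem_preimage (f := fun g : M i => v * of g)).2 (hCK₀ (hmem x hx)))
    (by
      rw [Finset.disjoint_left]
      intro g hg hgZ
      obtain ⟨x, hx, rfl⟩ := mem_image.1 hg
      exact Finset.disjoint_left.1 hdis (hmem x hx) (mem_image.2 ⟨_, hgZ, rfl⟩))
    (by
      rw [coe_image]
      refine hC.image fun x _ y _ hxy => ?_
      rcases head_eq_or_of_adj hU v i hxy with h | ⟨a, b, rfl, rfl, hab⟩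
      · exact .inl h
      · right; rwa [hπ, hπ])
  rw [hsumπ] at hsum
  have : ∑ x ∈ C, w x ≤ ∑ x ∈ K with π x ∈ C.image π, w x :=
    sum_le_sum_of_subset fun x hx => mem_filter.2 ⟨hCK hx, mem_image_of_mem π hx⟩
  omega

lemma groupSep_le {S : ∀ i, Finset (M i)} {U : Finset (CoprodI M)}
    (hU : ∀ u ∈ U, ∃ i, ∃ s ∈ S i, u = of s) {n m : ℕ} (hm : ∀ i, groupSep (S i) n ≤ m) :
    groupSep U n ≤ 9 * (m + 1) :=
  SimpleGraph.sepProfile_le fun K hK => exists_separates (U := (U : Set (CoprodI M)))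
    (fun u hu => hU u hu) hK hm _ (by simp)

lemma isFiniteGenSet_biUnion [Fintype ι] [DecidableEq (CoprodI M)] {S : ∀ i, Finset (M i)}
    (hS : ∀ i, IsFiniteGenSet (S i)) :
    IsFiniteGenSet (univ.biUnion fun i => (S i).image (of : M i →* CoprodI M)) := by
  rw [IsFiniteGenSet, eq_top_iff]
  intro x _
  induction x using CoprodI.induction_on with
  | one => exact one_mem _
  | of i m =>
    have hm : m ∈ Subgroup.closure (S i : Set (M i)) := by rw [hS i]; trivial
    have h1 := Subgroup.mem_map_of_mem (of : M i →* CoprodI M) hm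
    rw [MonoidHom.map_closure] at h1
    refine Subgroup.closure_mono ?_ h1
    rintro - ⟨s, hs, rfl⟩
    exact mem_coe.2 (mem_biUnion.2 ⟨i, mem_univ _, mem_image_of_mem _ hs⟩)
  | mul x y hx hy => exact mul_mem (hx trivial) (hy trivial)

end Monoid.CoprodI

-- Binary free products and the main theorem.

universe u v

/-- The two factors of a binary free product as a family in a common universe. -/
def coprodFactor (G : Type u) (H : Type v) : Bool → Type (max u v)
  | true => ULift.{v} G
  | false => ULift.{u} H

instance (G : Type u) (H : Type v) [Group G] [Group H] : ∀ b, Group (coprodFactor G H b)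
  | true => inferInstanceAs (Group (ULift.{v} G))
  | false => inferInstanceAs (Group (ULift.{u} H))

lemma IsFiniteGenSet.image {G H : Type*} [Group G] [Group H] [DecidableEq H] {S : Finset G}
    (hS : IsFiniteGenSet S) (e : G ≃* H) : IsFiniteGenSet (S.image e) := by
  have h := MonoidHom.map_closure (e : G →* H) (S : Set G)
  rw [hS, Subgroup.map_top_of_surjective _ e.surjective] at h
  rw [IsFiniteGenSet, coe_image]
  exact h.symm

/-- Upper bound for the separation profile of a free product. -/
theorem groupSep_coprod_coarseLE {G : Type u} {H : Type v} [Group G] [Group H] {S : Finset G}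
    {T : Finset H} (hS : IsFiniteGenSet S) (hT : IsFiniteGenSet T)
    (U : Finset (Monoid.Coprod G H)) :
    CoarseLE (groupSep U) fun r => max (groupSep S r) (groupSep T r) := by
  classical
  let eG : coprodFactor G H true ≃* G := MulEquiv.ulift
  let eH : coprodFactor G H false ≃* H := MulEquiv.ulift
  let R : ∀ b, Finset (coprodFactor G H b)
    | true => S.image eG.symm
    | false => T.image eH.symm
  have hR : ∀ b, IsFiniteGenSet (R b)
    | true => hS.image eG.symm
    | false => hT.image eH.symm
  let φ : Monoid.Coprod G H →* Monoid.CoprodI (coprodFactor G H) :=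
    Monoid.Coprod.lift (Monoid.CoprodI.of.comp eG.symm.toMonoidHom)
      (Monoid.CoprodI.of.comp eH.symm.toMonoidHom)
  let ψ : Monoid.CoprodI (coprodFactor G H) →* Monoid.Coprod G H :=
    Monoid.CoprodI.lift fun
      | true => Monoid.Coprod.inl.comp eG.toMonoidHom
      | false => Monoid.Coprod.inr.comp eH.toMonoidHom
  have hψφ : ψ.comp φ = MonoidHom.id _ := by
    ext x
    · simp [φ, ψ]
    · simp [φ, ψ]
  have hφ : Function.Injective φ :=
    Function.LeftInverse.injective (g := ψ) fun x => DFunLike.congr_fun hψφ x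
  let U₀ : Finset (Monoid.CoprodI (coprodFactor G H)) :=
    univ.biUnion fun b => (R b).image (Monoid.CoprodI.of)
  obtain ⟨C, hC⟩ := groupSep_coarseLE_of_injective φ hφ U
    (Monoid.CoprodI.isFiniteGenSet_biUnion hR)
  obtain ⟨A, hA⟩ := groupSep_coarseLE_of_injective eG.toMonoidHom eG.injective (R true) hS
  obtain ⟨B, hB⟩ := groupSep_coarseLE_of_injective eH.toMonoidHom eH.injective (R false) hT
  have hU₀ : ∀ u ∈ U₀, ∃ b, ∃ s ∈ R b, u = Monoid.CoprodI.of s := by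
    intro u hu
    obtain ⟨b, -, hb⟩ := mem_biUnion.1 hu
    obtain ⟨s, hs, rfl⟩ := mem_image.1 hb
    exact ⟨b, s, hs, rfl⟩
  -- Chosen so that `3 * D` dominates `A * C` and `B * C` in the argument and the accumulated factor
  -- `27 * (C + 1) * (A + B + 1)` in the value.
  let D := (A + B + 1) * (9 * (C + 1))
  refine ⟨3 * D, fun r => ?_⟩
  set m := max (groupSep S (3 * D * r)) (groupSep T (3 * D * r)) with hm
  have hAD : A * (C * r) ≤ 3 * D * r := by
    rw [← mul_assoc]; refine Nat.mul_le_mul_right _ ?_; simp only [D]; nlinarith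
  have hBD : B * (C * r) ≤ 3 * D * r := by
    rw [← mul_assoc]; refine Nat.mul_le_mul_right _ ?_; simp only [D]; nlinarith
  have hRm : ∀ b, groupSep (R b) (C * r) ≤ (A + B + 1) * (m + 1)
    | true => by
      have h1 := hA (C * r)
      have h2 : groupSep S (A * (C * r)) ≤ m :=
        (SimpleGraph.sepProfile_mono hAD).trans (le_max_left _ _)
      nlinarith [Nat.mul_le_mul_left A h2]
    | false => by
      have h1 := hB (C * r)
      have h2 : groupSep T (B * (C * r)) ≤ m :=
        (SimpleGraph.sepProfile_mono hBD).trans (le_max_right _ _)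
      nlinarith [Nat.mul_le_mul_left B h2]
  have h3 := Monoid.CoprodI.groupSep_le hU₀ hRm
  have h4 := (hC r).trans (Nat.add_le_add_right (Nat.mul_le_mul_left C h3) C)
  refine h4.trans ?_
  change _ ≤ 3 * D * m + 3 * D
  have h5 : 1 ≤ (A + B + 1) * (m + 1) := Nat.mul_pos (Nat.succ_pos _) (Nat.succ_pos _)
  calc C * (9 * ((A + B + 1) * (m + 1) + 1)) + C
      = 9 * C * ((A + B + 1) * (m + 1)) + 10 * C * 1 := by ring
    _ ≤ 9 * C * ((A + B + 1) * (m + 1)) + 10 * C * ((A + B + 1) * (m + 1)) := by gcongr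
    _ = 19 * C * ((A + B + 1) * (m + 1)) := by ring
    _ ≤ 27 * (C + 1) * ((A + B + 1) * (m + 1)) := Nat.mul_le_mul_right _ (by omega)
    _ = 3 * D * m + 3 * D := by simp only [D]; ring

lemma max_coarseLE {f f' g : ℕ → ℕ} (hg : Monotone g) (hf : CoarseLE f g) (hf' : CoarseLE f' g) :
    CoarseLE (fun r => max (f r) (f' r)) g := by
  obtain ⟨A, hA⟩ := hf
  obtain ⟨B, hB⟩ := hf'
  refine ⟨A + B, fun r => max_le ((hA r).trans ?_) ((hB r).trans ?_)⟩
  · exact add_le_add (Nat.mul_le_mul (Nat.le_add_right _ _)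
      (hg (Nat.mul_le_mul_right _ (Nat.le_add_right _ _)))) (Nat.le_add_right _ _)
  · exact add_le_add (Nat.mul_le_mul (Nat.le_add_left _ _)
      (hg (Nat.mul_le_mul_right _ (Nat.le_add_left _ _)))) (Nat.le_add_left _ _)

lemma Monoid.Coprod.group_fg {G H : Type*} [Group G] [Group H] [Group.FG G] [Group.FG H] :
    Group.FG (Monoid.Coprod G H) := by
  have h : (⊤ : Subgroup (Monoid.Coprod G H)).FG := by
    rw [← Monoid.Coprod.range_inl_sup_range_inr]
    exact Subgroup.FG.sup ((Group.fg_iff_subgroup_fg _).1 inferInstance)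
      ((Group.fg_iff_subgroup_fg _).1 inferInstance)
  exact ⟨h⟩

theorem theorem1 {G H : Type*} [Group G] [Group H] [Group.FG G] [Group.FG H] :
    Group.FG (Monoid.Coprod G H) ∧
      ∀ (S : Finset G) (T : Finset H) (U : Finset (Monoid.Coprod G H)),
        IsFiniteGenSet S → IsFiniteGenSet T → IsFiniteGenSet U →
          CoarseEquiv (groupSep U) (fun r => max (groupSep S r) (groupSep T r)) :=
  ⟨Monoid.Coprod.group_fg, fun S T U hS hT hU => ⟨groupSep_coprod_coarseLE hS hT U,
    max_coarseLE SimpleGraph.sepProfile_mono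
      (groupSep_coarseLE_of_injective _ Monoid.Coprod.inl_injective S hU)
      (groupSep_coarseLE_of_injective _ Monoid.Coprod.inr_injective T hU)⟩⟩
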